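/- Let $P^*=(p_1^*,\dots,p_n^*)$ be a probability distribution with $p_i^*>0$ for all $i$, let $P^0=(p_1^0,\dots,p_n^0)$ be a probability distribution ($p_i^0\ge 0$, $\sum_i p_i^0=1$), and let $J$ be a set of pairs of indices $(i,j)$ with $1\le j<i\le n$. For $i\ne j$ let $\gamma^{ji}\in\mathbb{R}^n$ be the vector with coordinate $-1$ at $j$, $+1$ at $i$, and $0$ elsewhere. Let $\mathcal{K}_J$ be the class of the detailed-balance master equations $$\frac{dP}{dt}=\sum_{i>j}w_{ij}^*\left(\frac{p_j}{p_j^*}-\frac{p_i}{p_i^*}\right)\gamma^{ji},\qquad w_{ij}^*\ge 0 \text{ for } (i,j)\in J,\quad w_{ij}^*=0 \text{ for } (i,j)\notin J,$$ and let $\Phi_J(P^0)$ be the set of all values $P(t)$, $t>0$, of solutions $P:[0,\infty)\to\mathbb{R}^n$ of all equations of the class $\mathcal{K}_J$ with $P(0)=P^0$. Let $$\mathbf{Q}_J(P^0,P^*)=\mathrm{cone}\left\{\gamma^{ji}\,\mathrm{sign}\left(\frac{p_j^0}{p_j^*}-\frac{p_i^0}{p_i^*}\right)\ \Big|\ (i,j)\in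 J\right\},$$ where $\mathrm{cone}$ denotes the set of all linear combinations with non-negative coefficients (it is $\{0\}$ for the empty set). If $\frac{p_j^0}{p_j^*}-\frac{p_i^0}{p_i^*}\neq 0$ for all $(i,j)\in J$, then there exists a neighbourhood $U$ of $P^0$ in $\mathbb{R}^n$ such that $$(P^0+\mathbf{Q}_J(P^0,P^*))\cap U=\Phi_J(P^0)\cap U .$$ -/

import Mathlib

open scoped Topology

namespace MarkovOrder

/-- The stoichiometric vector `γ^{ji}` of the transition `A_j → A_i` (for `i ≠ j`):
coordinate `-1` at `j`, `1` at `i`, and `0` elsewhere. -/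
def gammaVec {n : ℕ} (j i : Fin n) : Fin n → ℝ :=
  fun k => if k = j then -1 else if k = i then 1 else 0

/-- The right-hand side of the Kolmogorov equation with detailed balance in quasichemical form,
`∑_{i > j} w*_{ij} (p_j / p*_j - p_i / p*_i) γ^{ji}`, with equilibrium fluxes `w*_{ij}` (only the
values with `i > j` matter). -/
noncomputable def velocity {n : ℕ} (Pstar : Fin n → ℝ) (w : Fin n → Fin n → ℝ)
    (P : Fin n → ℝ) : Fin n → ℝ :=
  ∑ i : Fin n, ∑ j ∈ Finset.univ.filter (fun j : Fin n => j < i),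
    (w i j * (P j / Pstar j - P i / Pstar i)) • gammaVec j i

/-- `w` gives the equilibrium fluxes of an equation of the class `K_J`: nonnegative, and zero
for the transitions outside `J`. -/
def IsFlux {n : ℕ} (J : Set (Fin n × Fin n)) (w : Fin n → Fin n → ℝ) : Prop :=
  (∀ i j, 0 ≤ w i j) ∧ ∀ i j, (i, j) ∉ J → w i j = 0

/-- `P` is a solution on `[0, ∞)` of the equation with fluxes `w` and initial value `P0`. -/
def IsSolution {n : ℕ} (Pstar : Fin n → ℝ) (w : Fin n → Fin n → ℝ) (P0 : Fin n → ℝ)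
    (P : ℝ → Fin n → ℝ) : Prop :=
  P 0 = P0 ∧ ∀ t : ℝ, 0 ≤ t → HasDerivWithinAt P (velocity Pstar w (P t)) (Set.Ici 0) t

/-- `Φ_J(P⁰)`: all values `P(t)`, `t > 0`, of solutions of the equations of the class `K_J` with
`P(0) = P⁰`. -/
def reachable {n : ℕ} (Pstar : Fin n → ℝ) (J : Set (Fin n × Fin n)) (P0 : Fin n → ℝ) :
    Set (Fin n → ℝ) :=
  {x | ∃ w : Fin n → Fin n → ℝ, IsFlux J w ∧
    ∃ P : ℝ → Fin n → ℝ, IsSolution Pstar w P0 P ∧ ∃ t : ℝ, 0 < t ∧ P t = x}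

/-- The cone of possible velocities
`Q_J(P, P*) = cone {γ^{ji} sign (p_j / p*_j - p_i / p*_i) | (i, j) ∈ J}`. -/
noncomputable def velocityCone {n : ℕ} (J : Set (Fin n × Fin n)) (P Pstar : Fin n → ℝ) :
    PointedCone ℝ (Fin n → ℝ) :=
  PointedCone.hull ℝ
    {v | ∃ i j : Fin n, (i, j) ∈ J ∧ v = Real.sign (P j / Pstar j - P i / Pstar i) • gammaVec j i}

end MarkovOrder

/-!
By detailed balance the derivative of the quadratic free energy along `γ^{ji}` is minus the force
`p_j / p*_j - p_i / p*_i`, so a trajectory loses free energy at the rate `∑ w_e force_e²`. While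
the forces stay away from zero, this rate bounds the speed, and therefore a trajectory which ends
close to `P⁰` has been close to `P⁰` all along, however large the fluxes are. Along it the forces
keep their signs, and its displacement `∑ (w_e ∫ force_e) γ_e` lies in the cone.

Conversely, let the extent of a transition be `w_e ∫₀¹ force_e`. As a function of the fluxes, the
extents have the invertible derivative `diag (force_e (P⁰))` at zero, so by the inverse function
theorem all small extents are attained, and those with the signs of the forces are attained by
non-negative fluxes. Small elements of the cone have small extents, because the derivative of the
free energy is negative on all of its generators.
-/

namespace MarkovOrder

open Set Filter

section Calculus

variable {E F : Type*} [NormedAddCommGroup E] [NormedSpace ℝ E]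
  [NormedAddCommGroup F] [NormedSpace ℝ F]

theorem image_norm_lt_of_norm_deriv_right_le_deriv_boundary {f f' : ℝ → E} {B B' : ℝ → ℝ}
    {a b r : ℝ} (hf : ContinuousOn f (Icc a b))
    (hf' : ∀ x ∈ Ico a b, HasDerivWithinAt f (f' x) (Ici x) x) (ha : ‖f a‖ ≤ B a)
    (hB : ContinuousOn B (Icc a b)) (hB' : ∀ x ∈ Ico a b, HasDerivWithinAt B (B' x) (Ici x) x)
    (hr : ∀ x ∈ Icc a b, B x < r) (bound : ∀ x ∈ Ico a b, ‖f x‖ < r → ‖f' x‖ ≤ B' x) :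
    ∀ x ∈ Icc a b, ‖f x‖ < r := by
  intro x hx
  obtain ⟨m, hm, hmax⟩ := isCompact_Icc.exists_isMaxOn ⟨x, hx⟩ hB
  obtain ⟨ε, hε, hεr⟩ := exists_pos_mul_lt (sub_pos.2 (hr m hm)) (1 + (b - a))
  have hBr : ∀ y ∈ Icc a b, B y + ε * (1 + (y - a)) < r := fun y hy => by
    have hBm : B y ≤ B m := hmax hy
    have hyb : ε * (1 + (y - a)) ≤ ε * (1 + (b - a)) := by gcongr; exact hy.2
    linarith
  refine lt_of_le_of_lt (image_norm_le_of_norm_deriv_right_lt_deriv_boundary'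
    (B := fun y => B y + ε * (1 + (y - a))) (B' := fun y => B' y + ε) hf hf' ?_ ?_ ?_ ?_ hx)
    (hBr x hx)
  · simpa using ha.trans (le_add_of_nonneg_right hε.le)
  · exact hB.add (by fun_prop)
  · intro y hy
    have hlin : HasDerivWithinAt (fun y => ε * (1 + (y - a))) ε (Ici y) y := by
      simpa using (((hasDerivWithinAt_id y (Ici y)).sub_const a).const_add 1).const_mul ε
    exact (hB' y hy).add hlin
  · intro y hy hyB
    have hyr : ‖f y‖ < r := hyB ▸ hBr y (Ico_subset_Icc_self hy)
    exact (bound y hy hyr).trans_lt (lt_add_of_pos_right _ hε)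

theorem hasStrictFDerivAt_exp_clm_apply [CompleteSpace E] (A : F →L[ℝ] E →L[ℝ] E) (z : E) :
    HasStrictFDerivAt (fun w => NormedSpace.exp (A w) z) (A.flip z) 0 := by
  have hexp : HasStrictFDerivAt NormedSpace.exp (1 : (E →L[ℝ] E) →L[ℝ] E →L[ℝ] E) (A 0) := by
    rw [map_zero]
    exact hasStrictFDerivAt_exp_zero
  refine ((hexp.comp 0 A.hasStrictFDerivAt).clm_apply
    (hasStrictFDerivAt_const z 0)).congr_fderiv ?_
  ext w
  simp

end Calculus

/-- A system of elementary transitions, indexed by `ι`, on a state space `E`: the transition `e`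
moves the state along `direction e`, at a rate proportional to the thermodynamic force `force e`.
It isolates what the local description of the reachable set needs from the Markov setting. -/
structure LinearKinetics (ι E : Type*) [NormedAddCommGroup E] [NormedSpace ℝ E] where
  direction : ι → E
  force : ι → E →L[ℝ] ℝ

namespace LinearKinetics

variable {ι E : Type*} [NormedAddCommGroup E] [NormedSpace ℝ E] (K : LinearKinetics ι E)

/-- A free energy of `K`: a function whose slope along each transition is minus the force of that
transition. Detailed balance enters the argument only as the existence of such a function. -/
structure IsFreeEnergy (H : E → ℝ) : Prop where
  differentiable : Differentiable ℝ H
  fderiv_direction : ∀ x e, fderiv ℝ H x (K.direction e) = -K.force e x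

/-- The cone of possible velocities at `x₀`, spanned by the transitions oriented by the signs of
their forces. -/
noncomputable def cone (x₀ : E) : PointedCone ℝ E :=
  PointedCone.hull ℝ (range fun e => Real.sign (K.force e x₀) • K.direction e)

variable [Fintype ι]

/-- The change of state caused by the transitions `e` with extents `ξ e`. -/
noncomputable def displacement : (ι → ℝ) →L[ℝ] E :=
  ∑ e, (ContinuousLinearMap.proj (R := ℝ) (φ := fun _ : ι => ℝ) e).smulRight (K.direction e)

theorem displacement_apply (ξ : ι → ℝ) : K.displacement ξ = ∑ e, ξ e • K.direction e := by
  simp [displacement]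

/-- The right-hand side of the kinetic equation with fluxes `w`. -/
noncomputable def velocityField (w : ι → ℝ) (x : E) : E :=
  K.displacement fun e => w e * K.force e x

/-- The states reached from `x₀` at positive times, for all choices of constant non-negative
fluxes. -/
def reachableSet (x₀ : E) : Set E :=
  {y | ∃ w : ι → ℝ, (∀ e, 0 ≤ w e) ∧ ∃ x : ℝ → E,
    x 0 = x₀ ∧ IsIntegralCurveOn x (fun _ => K.velocityField w) (Ici 0) ∧ ∃ t, 0 < t ∧ x t = y}

variable {K} {x₀ : E}

theorem mem_cone_iff (hne : ∀ e, K.force e x₀ ≠ 0) {v : E} :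
    v ∈ K.cone x₀ ↔ ∃ ξ : ι → ℝ, (∀ e, 0 ≤ ξ e * K.force e x₀) ∧ K.displacement ξ = v := by
  simp only [cone, PointedCone.hull, Submodule.mem_span_range_iff_exists_fun, displacement_apply]
  constructor
  · rintro ⟨c, rfl⟩
    refine ⟨fun e => c e * Real.sign (K.force e x₀), fun e => ?_, ?_⟩
    · rw [mul_assoc]
      exact mul_nonneg (c e).2 (Real.sign_mul_nonneg _)
    · exact Finset.sum_congr rfl fun e _ => mul_smul _ _ _
  · rintro ⟨ξ, hξ, rfl⟩
    refine ⟨fun e => ⟨|ξ e|, abs_nonneg _⟩, Finset.sum_congr rfl fun e _ => ?_⟩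
    have hsign : |ξ e| * Real.sign (K.force e x₀) = ξ e := by
      rcases (hne e).lt_or_gt with h | h
      · rw [Real.sign_of_neg h, abs_of_nonpos (nonpos_of_mul_nonneg_left (hξ e) h)]
        ring
      · rw [Real.sign_of_pos h, abs_of_nonneg (nonneg_of_mul_nonneg_left (hξ e) h), mul_one]
    change |ξ e| • Real.sign (K.force e x₀) • K.direction e = ξ e • K.direction e
    rw [smul_smul, hsign]

section Trajectory

variable [CompleteSpace E] {w : ι → ℝ} {x : ℝ → E} {t : ℝ}

theorem eq_add_displacement (hx : IsIntegralCurveOn x (fun _ => K.velocityField w) (Ici 0))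
    (ht : 0 ≤ t) :
    x t = x 0 + K.displacement fun e => w e * ∫ s in (0 : ℝ)..t, K.force e (x s) := by
  have hcont : ContinuousOn x (Icc 0 t) := hx.continuousOn.mono Icc_subset_Ici_self
  have hint : ∀ e, IntervalIntegrable (fun s => (w e * K.force e (x s)) • K.direction e)
      MeasureTheory.volume 0 t := fun e =>
    ContinuousOn.intervalIntegrable_of_Icc ht (by fun_prop)
  have hftc := intervalIntegral.integral_eq_sub_of_hasDeriv_right_of_le ht hcont
    (fun s hs => (hx s hs.1.le).mono fun r hr => hs.1.le.trans (le_of_lt hr))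
    (by
      simpa only [velocityField, displacement_apply, Finset.sum_fn]
        using IntervalIntegrable.sum Finset.univ fun e _ => hint e)
  simp only [velocityField, displacement_apply] at hftc ⊢
  rw [intervalIntegral.integral_finsetSum fun e _ => hint e] at hftc
  simp only [intervalIntegral.integral_smul_const, intervalIntegral.integral_const_mul] at hftc
  rw [hftc, add_sub_cancel]

theorem sub_mem_cone (hne : ∀ e, K.force e x₀ ≠ 0) (hw : ∀ e, 0 ≤ w e) (hx0 : x 0 = x₀)
    (hx : IsIntegralCurveOn x (fun _ => K.velocityField w) (Ici 0)) (ht : 0 ≤ t)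
    (hsign : ∀ s ∈ Icc 0 t, ∀ e, 0 ≤ K.force e (x s) * K.force e x₀) : x t - x₀ ∈ K.cone x₀ := by
  refine (mem_cone_iff hne).2
    ⟨fun e => w e * ∫ s in (0 : ℝ)..t, K.force e (x s), fun e => ?_, ?_⟩
  · rw [mul_assoc, ← intervalIntegral.integral_mul_const]
    exact mul_nonneg (hw e) (intervalIntegral.integral_nonneg ht fun s hs => hsign s hs e)
  · rw [eq_add_displacement hx ht, hx0, add_sub_cancel_left]

end Trajectory

section FreeEnergy

variable {H : E → ℝ} {w : ι → ℝ} {x : ℝ → E} {t C δ r : ℝ}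

variable (K) in
/-- The rate of loss of free energy at `x`. -/
noncomputable def dissipation (w : ι → ℝ) (x : E) : ℝ :=
  ∑ e, w e * K.force e x ^ 2

theorem dissipation_nonneg (hw : ∀ e, 0 ≤ w e) (y : E) : 0 ≤ K.dissipation w y :=
  Finset.sum_nonneg fun e _ => mul_nonneg (hw e) (sq_nonneg _)

theorem norm_velocityField_le (hw : ∀ e, 0 ≤ w e) (hC : ∀ e, ‖K.direction e‖ ≤ C) (hδ : 0 < δ)
    {y : E} (hy : ∀ e, δ ≤ |K.force e y|) :
    ‖K.velocityField w y‖ ≤ C / δ * K.dissipation w y := by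
  rw [velocityField, displacement_apply, dissipation, Finset.mul_sum]
  refine norm_sum_le_of_le _ fun e _ => ?_
  have hforce : |K.force e y| ≤ K.force e y ^ 2 / δ := by
    rw [le_div_iff₀ hδ, ← sq_abs, sq]
    exact mul_le_mul_of_nonneg_left (hy e) (abs_nonneg _)
  calc ‖(w e * K.force e y) • K.direction e‖
      = w e * |K.force e y| * ‖K.direction e‖ := by
        rw [norm_smul, norm_mul, Real.norm_of_nonneg (hw e), Real.norm_eq_abs]
    _ ≤ w e * (K.force e y ^ 2 / δ) * C := by
        have hwe : 0 ≤ w e := hw e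
        gcongr
        exact hC e
    _ = C / δ * (w e * K.force e y ^ 2) := by ring

namespace IsFreeEnergy

theorem fderiv_displacement (hH : K.IsFreeEnergy H) (y : E) (ξ : ι → ℝ) :
    fderiv ℝ H y (K.displacement ξ) = -∑ e, ξ e * K.force e y := by
  simp [displacement_apply, hH.fderiv_direction]

theorem hasDerivWithinAt_comp (hH : K.IsFreeEnergy H)
    (hx : IsIntegralCurveOn x (fun _ => K.velocityField w) (Ici 0)) (ht : 0 ≤ t) :
    HasDerivWithinAt (H ∘ x) (-K.dissipation w (x t)) (Ici 0) t := by
  refine ((hH.differentiable (x t)).hasFDerivAt.comp_hasDerivWithinAt t (hx t ht)).congr_deriv ?_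
  simp only [velocityField, hH.fderiv_displacement, dissipation, sq, mul_assoc]

theorem antitoneOn_comp (hH : K.IsFreeEnergy H) (hw : ∀ e, 0 ≤ w e)
    (hx : IsIntegralCurveOn x (fun _ => K.velocityField w) (Ici 0)) :
    AntitoneOn (H ∘ x) (Ici 0) :=
  antitoneOn_of_hasDerivWithinAt_nonpos (convex_Ici 0)
    (fun _ ht => (hH.hasDerivWithinAt_comp hx ht).continuousWithinAt)
    (fun _ ht => (hH.hasDerivWithinAt_comp hx (interior_subset ht)).mono interior_subset)
    fun _ _ => neg_nonpos.2 (dissipation_nonneg hw _)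

theorem dist_lt_of_energy_loss_lt (hH : K.IsFreeEnergy H) (hw : ∀ e, 0 ≤ w e)
    (hx : IsIntegralCurveOn x (fun _ => K.velocityField w) (Ici 0)) (ht : 0 ≤ t)
    (hC0 : 0 ≤ C) (hC : ∀ e, ‖K.direction e‖ ≤ C) (hδ : 0 < δ)
    (hball : ∀ y, dist y (x 0) < r → ∀ e, δ ≤ |K.force e y|)
    (hHr : C / δ * (H (x 0) - H (x t)) < r) : ∀ s ∈ Icc 0 t, dist (x s) (x 0) < r := by
  simp only [dist_eq_norm] at hball ⊢
  have hHx : ∀ s ∈ Ico 0 t, HasDerivWithinAt (H ∘ x) (-K.dissipation w (x s)) (Ici s) s :=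
    fun s hs => (hH.hasDerivWithinAt_comp hx hs.1).mono (Ici_subset_Ici.2 hs.1)
  refine image_norm_lt_of_norm_deriv_right_le_deriv_boundary
    (f' := fun s => K.velocityField w (x s)) (B := fun s => C / δ * (H (x 0) - (H ∘ x) s))
    (B' := fun s => C / δ * K.dissipation w (x s)) ?_ ?_ (by simp) ?_ ?_ ?_ ?_
  · exact (hx.continuousOn.mono Icc_subset_Ici_self).sub continuousOn_const
  · exact fun s hs => ((hx s hs.1).mono (Ici_subset_Ici.2 hs.1)).sub_const _
  · have hcont : ContinuousOn (H ∘ x) (Icc 0 t) := hH.differentiable.continuous.comp_continuousOn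
      (hx.continuousOn.mono Icc_subset_Ici_self)
    exact continuousOn_const.mul (continuousOn_const.sub hcont)
  · exact fun s hs => (((hHx s hs).const_sub _).const_mul _).congr_deriv (by rw [neg_neg])
  · intro s hs
    have hHs : H (x t) ≤ H (x s) := hH.antitoneOn_comp hw hx hs.1 ht hs.2
    refine lt_of_le_of_lt ?_ hHr
    dsimp only [Function.comp_apply]
    gcongr
  · exact fun s _ hsr => norm_velocityField_le hw hC hδ (hball _ hsr)

theorem eventually_mem_cone_of_mem_reachableSet [CompleteSpace E] (hH : K.IsFreeEnergy H)
    (hne : ∀ e, K.force e x₀ ≠ 0) :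
    ∀ᶠ y in 𝓝 x₀, y ∈ K.reachableSet x₀ → y - x₀ ∈ K.cone x₀ := by
  obtain ⟨δ, hδ, hδ₀⟩ := Pi.exists_forall_pos_add_lt fun e => abs_pos.2 (hne e)
  have hforce : ∀ᶠ y in 𝓝 x₀, ∀ e, δ ≤ |K.force e y| ∧ 0 ≤ K.force e y * K.force e x₀ := by
    refine eventually_all.2 fun e => .and ?_ ?_
    · have hcont : Continuous fun y => |K.force e y| := by fun_prop
      exact (hcont.continuousAt.eventually_const_lt (by simpa using hδ₀ e)).mono fun _ => le_of_lt
    · have hcont : Continuous fun y => K.force e y * K.force e x₀ := by fun_prop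
      exact (hcont.continuousAt.eventually_const_lt (mul_self_pos.2 (hne e))).mono
        fun _ => le_of_lt
  obtain ⟨r, hr, hball⟩ := Metric.eventually_nhds_iff.1 hforce
  have hC : ∀ e, ‖K.direction e‖ ≤ ∑ e, ‖K.direction e‖ := fun e =>
    Finset.single_le_sum (fun _ _ => norm_nonneg _) (Finset.mem_univ e)
  have hnear : ∀ᶠ y in 𝓝 x₀, (∑ e, ‖K.direction e‖) / δ * (H x₀ - H y) < r := by
    have hcont : Continuous fun y => (∑ e, ‖K.direction e‖) / δ * (H x₀ - H y) :=
      continuous_const.mul (continuous_const.sub hH.differentiable.continuous)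
    exact hcont.continuousAt.eventually_lt_const (by simpa using hr)
  filter_upwards [hnear]
  rintro _ hy ⟨w, hw, x, rfl, hx, t, ht, rfl⟩
  have hstay := hH.dist_lt_of_energy_loss_lt hw hx ht.le
    (Finset.sum_nonneg fun _ _ => norm_nonneg _) hC hδ (fun y hy e => (hball hy e).1) hy
  exact sub_mem_cone hne hw rfl hx ht.le fun s hs e => (hball (hstay s hs) e).2

theorem eventually_forall_displacement_eq (hH : K.IsFreeEnergy H) (hne : ∀ e, K.force e x₀ ≠ 0)
    {p : (ι → ℝ) → Prop} (hp : ∀ᶠ ξ in 𝓝 0, p ξ) :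
    ∀ᶠ v in 𝓝 (0 : E), ∀ ξ : ι → ℝ,
      (∀ e, 0 ≤ ξ e * K.force e x₀) → K.displacement ξ = v → p ξ := by
  obtain ⟨δ, hδ, hδ₀⟩ := Pi.exists_forall_pos_add_lt fun e => abs_pos.2 (hne e)
  obtain ⟨ρ, hρ, hball⟩ := Metric.eventually_nhds_iff.1 hp
  have hslope : ∀ᶠ v in 𝓝 (0 : E), -fderiv ℝ H x₀ v < ρ * δ :=
    (fderiv ℝ H x₀).continuous.neg.continuousAt.eventually_lt_const (by simpa using mul_pos hρ hδ)
  filter_upwards [hslope]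
  rintro _ hξρ ξ hξ rfl
  rw [hH.fderiv_displacement, neg_neg] at hξρ
  refine hball ?_
  rw [dist_zero_right, pi_norm_lt_iff hρ]
  refine fun e => lt_of_mul_lt_mul_right ?_ hδ.le
  calc |ξ e| * δ ≤ |ξ e| * |K.force e x₀| := by
        gcongr
        simpa using (hδ₀ e).le
    _ = ξ e * K.force e x₀ := by rw [← abs_mul, abs_of_nonneg (hξ e)]
    _ ≤ ∑ e, ξ e * K.force e x₀ :=
      Finset.single_le_sum (f := fun e => ξ e * K.force e x₀) (fun e _ => hξ e) (Finset.mem_univ e)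
    _ < ρ * δ := hξρ

end IsFreeEnergy

end FreeEnergy

section Extent

variable (K)

/-- The generator, depending linearly on the fluxes `w`, of the motion of a state together with the
extents of the transitions: `ξ' e = w e * force e x` and `x' = velocityField w x`. -/
noncomputable def extentGenerator : (ι → ℝ) →L[ℝ] (ι → ℝ) × E →L[ℝ] (ι → ℝ) × E :=
  ∑ e, (ContinuousLinearMap.proj (R := ℝ) (φ := fun _ : ι => ℝ) e).smulRight
    (((K.force e).comp (ContinuousLinearMap.snd ℝ (ι → ℝ) E)).smulRight
      ((open Classical in Pi.single e 1 : ι → ℝ), K.direction e))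

theorem extentGenerator_apply (w : ι → ℝ) (z : (ι → ℝ) × E) :
    K.extentGenerator w z = (fun e => w e * K.force e z.2, K.velocityField w z.2) := by
  classical
  ext e
  · simp [extentGenerator, Prod.fst_sum, Finset.sum_apply, Pi.single_apply]
  · simp [extentGenerator, Prod.snd_sum, velocityField, displacement_apply, mul_smul]

/-- The extents and the state at time `t`, starting from the state `x₀` with zero extents. -/
noncomputable def extentFlow (x₀ : E) (w : ι → ℝ) (t : ℝ) : (ι → ℝ) × E :=
  NormedSpace.exp (t • K.extentGenerator w) (0, x₀)

theorem extentFlow_zero_right (x₀ : E) (w : ι → ℝ) : K.extentFlow x₀ w 0 = (0, x₀) := by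
  simp [extentFlow]

theorem extentFlow_zero_flux (x₀ : E) (t : ℝ) : K.extentFlow x₀ 0 t = (0, x₀) := by
  simp [extentFlow]

variable [CompleteSpace E]

theorem hasDerivAt_extentFlow (x₀ : E) (w : ι → ℝ) (t : ℝ) :
    HasDerivAt (K.extentFlow x₀ w) (fun e => w e * K.force e (K.extentFlow x₀ w t).2,
      K.velocityField w (K.extentFlow x₀ w t).2) t := by
  have h := (hasDerivAt_exp_smul_const' (𝕂 := ℝ) (K.extentGenerator w) t).clm_apply
    (hasDerivAt_const t ((0, x₀) : (ι → ℝ) × E))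
  rwa [map_zero, add_zero, mul_apply_eq_comp, extentGenerator_apply] at h

theorem continuous_extentFlow (x₀ : E) : Continuous (Function.uncurry (K.extentFlow x₀)) := by
  have hexp : Continuous (NormedSpace.exp : ((ι → ℝ) × E →L[ℝ] (ι → ℝ) × E) → _) :=
    continuous_iff_continuousAt.2 fun A => (NormedSpace.exp_analytic (𝕂 := ℝ) A).continuousAt
  unfold extentFlow Function.uncurry
  fun_prop

theorem isIntegralCurve_extentFlow_snd (x₀ : E) (w : ι → ℝ) :
    IsIntegralCurve (fun t => (K.extentFlow x₀ w t).2) (fun _ => K.velocityField w) := fun t =>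
  (K.hasDerivAt_extentFlow x₀ w t).snd

theorem extentFlow_fst_apply (x₀ : E) (w : ι → ℝ) (t : ℝ) (e : ι) :
    (K.extentFlow x₀ w t).1 e = w e * ∫ s in (0 : ℝ)..t, K.force e (K.extentFlow x₀ w s).2 := by
  have hcont : Continuous fun s => w e * K.force e (K.extentFlow x₀ w s).2 := by
    have hflow := (K.continuous_extentFlow x₀).comp (Continuous.prodMk_right w)
    fun_prop
  rw [← intervalIntegral.integral_const_mul, intervalIntegral.integral_eq_sub_of_hasDerivAt
    (fun s _ => hasDerivAt_pi.1 (K.hasDerivAt_extentFlow x₀ w s).fst e)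
    (hcont.intervalIntegrable 0 t)]
  simp [extentFlow_zero_right]

variable {K}

theorem map_extentFlow_nhds_zero (hne : ∀ e, K.force e x₀ ≠ 0) :
    map (fun w => (K.extentFlow x₀ w 1).1) (𝓝 0) = 𝓝 0 := by
  have hderiv : HasStrictFDerivAt (fun w => (K.extentFlow x₀ w 1).1)
      ((ContinuousLinearMap.fst ℝ (ι → ℝ) E).comp (K.extentGenerator.flip (0, x₀))) 0 := by
    simpa only [extentFlow, one_smul] using
      (hasStrictFDerivAt_exp_clm_apply K.extentGenerator (0, x₀)).fst
  have hsurj : ((ContinuousLinearMap.fst ℝ (ι → ℝ) E).comp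
      (K.extentGenerator.flip (0, x₀))).range = ⊤ := by
    refine LinearMap.range_eq_top.2 fun ξ => ⟨fun e => ξ e / K.force e x₀, ?_⟩
    ext e
    simp [extentGenerator_apply, div_mul_cancel₀ _ (hne e)]
  simpa only [extentFlow_zero_flux] using hderiv.map_nhds_eq_of_surj hsurj

theorem eventually_integral_force_mul_pos (hne : ∀ e, K.force e x₀ ≠ 0) :
    ∀ᶠ w in 𝓝 (0 : ι → ℝ), ∀ e,
      0 < (∫ s in (0 : ℝ)..1, K.force e (K.extentFlow x₀ w s).2) * K.force e x₀ := by
  refine eventually_all.2 fun e => ?_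
  have hforce : Continuous (Function.uncurry fun w s => K.force e (K.extentFlow x₀ w s).2) :=
    (K.force e).continuous.comp (K.continuous_extentFlow x₀).snd
  have hcont : Continuous fun w => ∫ s in (0 : ℝ)..1, K.force e (K.extentFlow x₀ w s).2 :=
    intervalIntegral.continuous_parametric_intervalIntegral_of_continuous' hforce 0 1
  refine (hcont.mul continuous_const).continuousAt.eventually_const_lt ?_
  simpa [extentFlow_zero_flux] using hne e

theorem eventually_add_displacement_mem_reachableSet (hne : ∀ e, K.force e x₀ ≠ 0) :
    ∀ᶠ ξ in 𝓝 (0 : ι → ℝ), (∀ e, 0 ≤ ξ e * K.force e x₀) →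
      x₀ + K.displacement ξ ∈ K.reachableSet x₀ := by
  rw [← map_extentFlow_nhds_zero hne, eventually_map]
  filter_upwards [eventually_integral_force_mul_pos hne] with w hpos hsign
  have hcurve := (K.isIntegralCurve_extentFlow_snd x₀ w).isIntegralCurveOn (Ici 0)
  refine ⟨w, fun e => ?_, _, by rw [extentFlow_zero_right], hcurve, 1, one_pos, ?_⟩
  · have hwe := hsign e
    rw [extentFlow_fst_apply, mul_assoc] at hwe
    exact nonneg_of_mul_nonneg_left hwe (hpos e)
  · simp only [eq_add_displacement hcurve zero_le_one, extentFlow_zero_right,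
      ← extentFlow_fst_apply]

end Extent

theorem IsFreeEnergy.eventually_sub_mem_cone_iff [CompleteSpace E] {H : E → ℝ}
    (hH : K.IsFreeEnergy H) (hne : ∀ e, K.force e x₀ ≠ 0) :
    ∀ᶠ y in 𝓝 x₀, y - x₀ ∈ K.cone x₀ ↔ y ∈ K.reachableSet x₀ := by
  have hsub : Tendsto (fun y => y - x₀) (𝓝 x₀) (𝓝 0) := tendsto_sub_nhds_zero_iff.2 tendsto_id
  filter_upwards [hH.eventually_mem_cone_of_mem_reachableSet hne,
    hsub.eventually (hH.eventually_forall_displacement_eq hne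
      (eventually_add_displacement_mem_reachableSet hne))] with y hcone hreach
  refine ⟨fun hy => ?_, hcone⟩
  obtain ⟨ξ, hξ, hξy⟩ := (mem_cone_iff hne).1 hy
  have hmem := hreach ξ hξ hξy hξ
  rwa [hξy, add_sub_cancel] at hmem

end LinearKinetics

section Markov

variable {n : ℕ} {J : Set (Fin n × Fin n)}

/-- The transitions of the Markov chains of the class `K_J`, as a system of elementary transitions
indexed by `J`; the force of `(i, j)` is `p_j / p*_j - p_i / p*_i`. -/
noncomputable def detailedBalance (Pstar : Fin n → ℝ) (J : Set (Fin n × Fin n)) :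
    LinearKinetics J (Fin n → ℝ) where
  direction e := gammaVec e.1.2 e.1.1
  force e := (Pstar e.1.2)⁻¹ • ContinuousLinearMap.proj e.1.2 -
    (Pstar e.1.1)⁻¹ • ContinuousLinearMap.proj e.1.1

theorem detailedBalance_force_apply (Pstar P : Fin n → ℝ) (e : J) :
    (detailedBalance Pstar J).force e P = P e.1.2 / Pstar e.1.2 - P e.1.1 / Pstar e.1.1 := by
  simp [detailedBalance, div_eq_inv_mul]

theorem cone_detailedBalance (Pstar P : Fin n → ℝ) :
    (detailedBalance Pstar J).cone P = velocityCone J P Pstar := by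
  rw [LinearKinetics.cone, velocityCone]
  congr 1
  ext v
  simp [detailedBalance, div_eq_inv_mul, eq_comm]

theorem velocity_eq_velocityField [Fintype J] (Pstar : Fin n → ℝ)
    (hJ : ∀ i j : Fin n, (i, j) ∈ J → j < i) {w : Fin n → Fin n → ℝ}
    (hw : ∀ i j, (i, j) ∉ J → w i j = 0) :
    velocity Pstar w = (detailedBalance Pstar J).velocityField fun e => w e.1.1 e.1.2 := by
  ext1 P
  simp only [velocity, Finset.sum_filter, LinearKinetics.velocityField,
    LinearKinetics.displacement_apply, detailedBalance_force_apply]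
  rw [← Fintype.sum_prod_type' fun i j : Fin n => if j < i then
      (w i j * (P j / Pstar j - P i / Pstar i)) • gammaVec j i else 0,
    ← Finset.sum_subset (Finset.subset_univ J.toFinset),
    Finset.sum_subtype J.toFinset fun _ => mem_toFinset]
  · exact Finset.sum_congr rfl fun e _ => if_pos (hJ _ _ e.2)
  · rintro ⟨i, j⟩ _ he
    simp [hw i j (by simpa using he)]

theorem reachableSet_detailedBalance [Fintype J] (Pstar P0 : Fin n → ℝ)
    (hJ : ∀ i j : Fin n, (i, j) ∈ J → j < i) :
    (detailedBalance Pstar J).reachableSet P0 = reachable Pstar J P0 := by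
  classical
  ext y
  constructor
  · rintro ⟨w, hw, x, hx0, hx, hy⟩
    let w' (i j : Fin n) : ℝ := if h : (i, j) ∈ J then w ⟨(i, j), h⟩ else 0
    have hw' : IsFlux J w' := by
      refine ⟨fun i j => ?_, fun i j h => dif_neg h⟩
      by_cases h : (i, j) ∈ J <;> simp [w', h, hw]
    have hww' : (fun e : J => w' e.1.1 e.1.2) = w := by simp [w']
    refine ⟨w', hw', x, ⟨hx0, fun t ht => ?_⟩, hy⟩
    rw [velocity_eq_velocityField Pstar hJ hw'.2, hww']
    exact hx t ht
  · rintro ⟨w, hw, x, ⟨hx0, hx⟩, hy⟩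
    rw [velocity_eq_velocityField Pstar hJ hw.2] at hx
    exact ⟨_, fun e => hw.1 _ _, x, hx0, hx, hy⟩

theorem gammaVec_eq_single_sub_single {i j : Fin n} (hij : j ≠ i) :
    gammaVec j i = Pi.single i 1 - Pi.single j (1 : ℝ) := by
  ext k
  simp only [gammaVec, Pi.sub_apply, Pi.single_apply]
  grind

/-- The quadratic free energy `∑ p_i² / (2 p*_i)`, which for probability distributions differs from
half the `χ²`-divergence from `P*` by a constant. -/
noncomputable def quadraticEnergy (Pstar P : Fin n → ℝ) : ℝ :=
  ∑ i, P i ^ 2 / (2 * Pstar i)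

theorem hasFDerivAt_quadraticEnergy (Pstar P : Fin n → ℝ) :
    HasFDerivAt (quadraticEnergy Pstar)
      (∑ i, (P i / Pstar i) • ContinuousLinearMap.proj (R := ℝ) (φ := fun _ : Fin n => ℝ) i) P := by
  refine HasFDerivAt.fun_sum fun i _ => ?_
  refine (((hasFDerivAt_apply (𝕜 := ℝ) i P).pow 2).mul_const (2 * Pstar i)⁻¹).congr_fderiv ?_
  ext v
  simp only [mul_inv_rev, Nat.add_one_sub_one, pow_one, nsmul_eq_mul, Nat.cast_ofNat, smul_apply,
    ContinuousLinearMap.proj_apply, smul_eq_mul]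
  ring

theorem isFreeEnergy_quadraticEnergy (Pstar : Fin n → ℝ)
    (hJ : ∀ i j : Fin n, (i, j) ∈ J → j ≠ i) :
    (detailedBalance Pstar J).IsFreeEnergy (quadraticEnergy Pstar) where
  differentiable P := (hasFDerivAt_quadraticEnergy Pstar P).differentiableAt
  fderiv_direction P e := by
    rw [(hasFDerivAt_quadraticEnergy Pstar P).fderiv, detailedBalance_force_apply]
    simp [detailedBalance, gammaVec_eq_single_sub_single (hJ _ _ e.2), Pi.single_apply,
      mul_sub, Finset.sum_sub_distrib]

end Markov

end MarkovOrder

theorem proposition1_general (n : ℕ) (Pstar P0 : Fin n → ℝ) (_hPstar : ∀ i, Pstar i ≠ 0)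
    (J : Set (Fin n × Fin n)) (hJ : ∀ i j : Fin n, (i, j) ∈ J → j < i)
    (hne : ∀ i j : Fin n, (i, j) ∈ J → P0 j / Pstar j - P0 i / Pstar i ≠ 0) :
    ∃ U ∈ 𝓝 P0,
      ((fun v => P0 + v) '' (MarkovOrder.velocityCone J P0 Pstar : Set (Fin n → ℝ))) ∩ U =
        MarkovOrder.reachable Pstar J P0 ∩ U := by
  have := Fintype.ofFinite J
  have hforce : ∀ e : J, (MarkovOrder.detailedBalance Pstar J).force e P0 ≠ 0 := fun e => by
    rw [MarkovOrder.detailedBalance_force_apply]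
    exact hne _ _ e.2
  have hlocal := (MarkovOrder.isFreeEnergy_quadraticEnergy Pstar
    fun i j hij => (hJ i j hij).ne).eventually_sub_mem_cone_iff hforce
  rw [MarkovOrder.cone_detailedBalance, MarkovOrder.reachableSet_detailedBalance Pstar P0 hJ]
    at hlocal
  refine ⟨_, hlocal, Set.ext fun y => and_congr_left fun hy => ?_⟩
  rw [Set.image_add_left, Set.mem_preimage, neg_add_eq_sub]
  exact hy

theorem proposition1 (n : ℕ) (Pstar P0 : Fin n → ℝ)
    (hPstar : Pstar ∈ stdSimplex ℝ (Fin n)) (hPstar_pos : ∀ i, 0 < Pstar i)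
    (hP0 : P0 ∈ stdSimplex ℝ (Fin n))
    (J : Set (Fin n × Fin n)) (hJ : ∀ i j : Fin n, (i, j) ∈ J → j < i)
    (hne : ∀ i j : Fin n, (i, j) ∈ J → P0 j / Pstar j - P0 i / Pstar i ≠ 0) :
    ∃ U ∈ 𝓝 P0,
      ((fun v => P0 + v) '' (MarkovOrder.velocityCone J P0 Pstar : Set (Fin n → ℝ))) ∩ U =
        MarkovOrder.reachable Pstar J P0 ∩ U :=
  proposition1_general n Pstar P0 (fun i => (hPstar_pos i).ne') J hJ hne
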